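/- Let $M$ be a smooth (Hausdorff, finite-dimensional, boundaryless) manifold; all functions, forms and tensor fields are $C^\infty$. Let $\chi(M)$ be the space of vector fields and $\Omega^1(M)$ the space of 1-forms. A bivector field $\Lambda$ is identified with the skew-symmetric bundle map $\Lambda : T^*M \to TM$ given by $\langle \beta, \Lambda\alpha\rangle = \Lambda(\alpha,\beta)$; for a $(1,1)$-tensor field $J$ the transpose is ${}^tJ\alpha = \alpha\circ J$; $L_X = i_X d + d\, i_X$ is the Lie derivative of forms; $[\cdot,\cdot]$ is the Lie, respectively Schouten–Nijenhuis, bracket. Definitions. (1) A bivector field $\pi$ is a *Poisson tensor* if $[\pi,\pi]=0$. It is *homogeneous* with respect to a vector field $Z$ if $[Z,\pi]=-\pi$, where $[Z,\pi](\alpha,\beta)=Z(\pi(\alpha,\beta))-\pi(L_Z\alpha,\beta)-\pi(\alpha,L_Z\beta)$; if moreover $\pi$ is Poisson, then $(M,\pi,Z)$ is a *homogeneous Poisson manifold*. (2) A $(1,1)$-tensor field $J$ is a *Nijenhuis tensor* if $[JX,JY]-J[JX,Y]-J[X,JY]+J^2[X,Y]=0$ for all $X,Y\in\chi(M)$. (3)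 $\pi$ and $J$ are *compatible* if $J\circ\pi=\pi\circ{}^tJ$ and $C(\pi,J)=0$, where $$C(\pi,J)(\alpha,\beta)=\{\alpha,\beta\}_{J\pi}-\big(\{{}^tJ\alpha,\beta\}_\pi+\{\alpha,{}^tJ\beta\}_\pi-{}^tJ\{\alpha,\beta\}_\pi\big),\qquad \{\alpha,\beta\}_\Lambda=L_{\Lambda\alpha}\beta-L_{\Lambda\beta}\alpha-d(\Lambda(\alpha,\beta)).$$ (4) $(M,\pi,J)$ is a *Poisson–Nijenhuis manifold* if $\pi$ is a Poisson tensor, $J$ is a Nijenhuis tensor, and $\pi$ and $J$ are compatible. (5) $(M,\pi,J)$ is a *homogeneous Poisson–Nijenhuis manifold with respect to $Z$* if $(M,\pi,Z)$ is a homogeneous Poisson manifold, $J$ is a Nijenhuis tensor compatible with $\pi$, and $$\pi\circ(L_Z\circ{}^tJ-{}^tJ\circ L_Z)=0\quad\text{on }\Omega^1(M).$$ Statement. Let $(M,\pi,J)$ be a Poisson–Nijenhuis manifold and let $Z$ be a vector field on $M$ such that $\pi$ is homogeneous with respect to $Z$. If $[Z,JX]=J[Z,X]$ for all $X\in\chi(M)$,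 then $(M,\pi,J)$ is a homogeneous Poisson–Nijenhuis manifold with respect to $Z$. -/

import Mathlib

open scoped Manifold ContDiff

noncomputable section

namespace PoissonNijenhuis

section Fields

variable (E : Type*) [NormedAddCommGroup E] [NormedSpace ℝ E]
  (M : Type*) [TopologicalSpace M] [ChartedSpace E M]

/-- Smooth real valued functions on the manifold `M` (without boundary, modelled on `E`). -/
abbrev SmoothFunction : Type _ := C^∞⟮𝓘(ℝ, E), M; ℝ⟯

variable [IsManifold 𝓘(ℝ, E) ∞ M]

/-- Smooth vector fields: smooth sections of the tangent bundle. -/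
abbrev VectorField : Type _ :=
  Cₛ^∞⟮𝓘(ℝ, E); E, fun x : M => TangentSpace 𝓘(ℝ, E) x⟯

/-- Smooth differential 1-forms: smooth sections of the cotangent bundle. -/
abbrev OneForm : Type _ :=
  Cₛ^∞⟮𝓘(ℝ, E); E →L[ℝ] ℝ, fun x : M => TangentSpace 𝓘(ℝ, E) x →L[ℝ] ℝ⟯

/-- Smooth (1,1)-tensor fields: smooth sections of the endomorphism bundle of `TM`. -/
abbrev TensorField : Type _ :=
  Cₛ^∞⟮𝓘(ℝ, E); E →L[ℝ] E,
    fun x : M => TangentSpace 𝓘(ℝ, E) x →L[ℝ] TangentSpace 𝓘(ℝ, E) x⟯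

/-- Smooth bivector fields, given as smooth bundle maps `Λ : T*M → TM` that are skew-symmetric;
the corresponding bilinear form on covectors is `Λ(a, b) = ⟨b, Λ a⟩`. -/
structure BivectorField where
  /-- The underlying smooth bundle map `T*M → TM`. -/
  sharp : Cₛ^∞⟮𝓘(ℝ, E); (E →L[ℝ] ℝ) →L[ℝ] E,
    fun x : M => (TangentSpace 𝓘(ℝ, E) x →L[ℝ] ℝ) →L[ℝ] TangentSpace 𝓘(ℝ, E) x⟯
  skew : ∀ (x : M) (a b : TangentSpace 𝓘(ℝ, E) x →L[ℝ] ℝ),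
    b (sharp x a) = - a (sharp x b)

end Fields

section Operators

/-! The operators of this section are defined on arbitrary sections (families of vectors,
covectors, ...) and have their usual meaning on smooth ones. -/

variable {E : Type*} [NormedAddCommGroup E] [NormedSpace ℝ E]
  {M : Type*} [TopologicalSpace M] [ChartedSpace E M]

/-- The Lie bracket `[X, Y]` of vector fields. -/
abbrev bracket (X Y : ∀ x : M, TangentSpace 𝓘(ℝ, E) x) (x : M) : TangentSpace 𝓘(ℝ, E) x :=
  VectorField.mlieBracket 𝓘(ℝ, E) X Y x

/-- The differential `df` of a function. -/
def dFun (f : M → ℝ) (x : M) : TangentSpace 𝓘(ℝ, E) x →L[ℝ] ℝ :=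
  mfderiv 𝓘(ℝ, E) 𝓘(ℝ, ℝ) f x

/-- The expression of a 1-form in the preferred chart `φ` at `x`, that is `(φ⁻¹)^* α`. -/
def formInChart (α : ∀ x : M, TangentSpace 𝓘(ℝ, E) x →L[ℝ] ℝ) (x : M) (y : E) : E →L[ℝ] ℝ :=
  (α ((extChartAt 𝓘(ℝ, E) x).symm y)).comp
    (mfderiv 𝓘(ℝ, E) 𝓘(ℝ, E) (extChartAt 𝓘(ℝ, E) x).symm y)

/-- The exterior derivative `dα` of a 1-form at `x`, as a bilinear form on the tangent space at
`x`. It is computed in the preferred chart `φ` at `x`: with `a = (φ⁻¹)^* α`,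
`dα(u, v) = (D a)(φ_* u)(φ_* v) - (D a)(φ_* v)(φ_* u)`. -/
def dForm (α : ∀ x : M, TangentSpace 𝓘(ℝ, E) x →L[ℝ] ℝ) (x : M) :
    TangentSpace 𝓘(ℝ, E) x →L[ℝ] TangentSpace 𝓘(ℝ, E) x →L[ℝ] ℝ :=
  let D : E →L[ℝ] E →L[ℝ] ℝ := fderiv ℝ (formInChart α x) (extChartAt 𝓘(ℝ, E) x x)
  let p : E →L[ℝ] E := mfderiv 𝓘(ℝ, E) 𝓘(ℝ, E) (extChartAt 𝓘(ℝ, E) x) x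
  let B : E →L[ℝ] E →L[ℝ] ℝ := (D - D.flip).bilinearComp p p
  B

/-- The Lie derivative of 1-forms, `L_X α = i_X dα + d(i_X α)`. -/
def lieForm (X : ∀ x : M, TangentSpace 𝓘(ℝ, E) x)
    (α : ∀ x : M, TangentSpace 𝓘(ℝ, E) x →L[ℝ] ℝ) (x : M) : TangentSpace 𝓘(ℝ, E) x →L[ℝ] ℝ :=
  dForm α x (X x) + dFun (fun y => α y (X y)) x

/-- The transpose of a (1,1)-tensor field acting on 1-forms, `ᵗJ α = α ∘ J`. -/
def transpose (J : ∀ x : M, TangentSpace 𝓘(ℝ, E) x →L[ℝ] TangentSpace 𝓘(ℝ, E) x)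
    (α : ∀ x : M, TangentSpace 𝓘(ℝ, E) x →L[ℝ] ℝ) (x : M) : TangentSpace 𝓘(ℝ, E) x →L[ℝ] ℝ :=
  (α x).comp (J x)

/-- The function `Λ(α, β) = ⟨β, Λ α⟩`. -/
def pair (Λ : ∀ x : M, (TangentSpace 𝓘(ℝ, E) x →L[ℝ] ℝ) →L[ℝ] TangentSpace 𝓘(ℝ, E) x)
    (α β : ∀ x : M, TangentSpace 𝓘(ℝ, E) x →L[ℝ] ℝ) (x : M) : ℝ :=
  β x (Λ x (α x))

/-- The bracket of 1-forms `{α, β}_Λ = L_{Λα} β - L_{Λβ} α - d(Λ(α, β))`. -/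
def formBracket (Λ : ∀ x : M, (TangentSpace 𝓘(ℝ, E) x →L[ℝ] ℝ) →L[ℝ] TangentSpace 𝓘(ℝ, E) x)
    (α β : ∀ x : M, TangentSpace 𝓘(ℝ, E) x →L[ℝ] ℝ) (x : M) : TangentSpace 𝓘(ℝ, E) x →L[ℝ] ℝ :=
  lieForm (fun y => Λ y (α y)) β x - lieForm (fun y => Λ y (β y)) α x - dFun (pair Λ α β) x

/-- The concomitant
`C(Λ, J)(α, β) = {α, β}_{JΛ} - ({ᵗJα, β}_Λ + {α, ᵗJβ}_Λ - ᵗJ{α, β}_Λ)`. -/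
def concomitant
    (Λ : ∀ x : M, (TangentSpace 𝓘(ℝ, E) x →L[ℝ] ℝ) →L[ℝ] TangentSpace 𝓘(ℝ, E) x)
    (J : ∀ x : M, TangentSpace 𝓘(ℝ, E) x →L[ℝ] TangentSpace 𝓘(ℝ, E) x)
    (α β : ∀ x : M, TangentSpace 𝓘(ℝ, E) x →L[ℝ] ℝ) (x : M) : TangentSpace 𝓘(ℝ, E) x →L[ℝ] ℝ :=
  formBracket (fun y => (J y).comp (Λ y)) α β x
    - (formBracket Λ (transpose J α) β x + formBracket Λ α (transpose J β) x
      - transpose J (formBracket Λ α β) x)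

/-- The Nijenhuis torsion `N_J(X, Y) = [JX, JY] - J[JX, Y] - J[X, JY] + J²[X, Y]`. -/
def torsion (J : ∀ x : M, TangentSpace 𝓘(ℝ, E) x →L[ℝ] TangentSpace 𝓘(ℝ, E) x)
    (X Y : ∀ x : M, TangentSpace 𝓘(ℝ, E) x) (x : M) : TangentSpace 𝓘(ℝ, E) x :=
  bracket (fun y => J y (X y)) (fun y => J y (Y y)) x
    - J x (bracket (fun y => J y (X y)) Y x) - J x (bracket X (fun y => J y (Y y)) x)
    + J x (J x (bracket X Y x))

/-- The Schouten-Nijenhuis bracket of two bivector fields, evaluated on exact 1-forms (which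
determines it):
`[P, Q](df, dg, dh) = ∑_{cyc} (P(d(Q(df, dg)), dh) + Q(d(P(df, dg)), dh))`. -/
def schouten (P Q : ∀ x : M, (TangentSpace 𝓘(ℝ, E) x →L[ℝ] ℝ) →L[ℝ] TangentSpace 𝓘(ℝ, E) x)
    (f g h : M → ℝ) (x : M) : ℝ :=
  let c : (M → ℝ) → (M → ℝ) → (M → ℝ) → ℝ := fun f₁ f₂ f₃ =>
    pair P (dFun (pair Q (dFun f₁) (dFun f₂))) (dFun f₃) x
      + pair Q (dFun (pair P (dFun f₁) (dFun f₂))) (dFun f₃) x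
  c f g h + c g h f + c h f g

/-- The Schouten-Nijenhuis bracket of a vector field and a bivector field, i.e. the Lie
derivative `[Z, Λ](α, β) = Z(Λ(α, β)) - Λ(L_Z α, β) - Λ(α, L_Z β)`. -/
def lieBivector (Z : ∀ x : M, TangentSpace 𝓘(ℝ, E) x)
    (Λ : ∀ x : M, (TangentSpace 𝓘(ℝ, E) x →L[ℝ] ℝ) →L[ℝ] TangentSpace 𝓘(ℝ, E) x)
    (α β : ∀ x : M, TangentSpace 𝓘(ℝ, E) x →L[ℝ] ℝ) (x : M) : ℝ :=
  dFun (pair Λ α β) x (Z x) - pair Λ (lieForm Z α) β x - pair Λ α (lieForm Z β) x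

end Operators

section Structures

variable {E : Type*} [NormedAddCommGroup E] [NormedSpace ℝ E]
  {M : Type*} [TopologicalSpace M] [ChartedSpace E M] [IsManifold 𝓘(ℝ, E) ∞ M]

/-- `π` is a Poisson tensor: `[π, π] = 0`. -/
def IsPoisson (π : BivectorField E M) : Prop :=
  ∀ (f g h : SmoothFunction E M) (x : M), schouten π.sharp π.sharp f g h x = 0

/-- `J` is a Nijenhuis tensor: its Nijenhuis torsion vanishes. -/
def IsNijenhuis (J : TensorField E M) : Prop :=
  ∀ (X Y : VectorField E M) (x : M), torsion J X Y x = 0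

/-- `π` and `J` are compatible: `J ∘ π = π ∘ ᵗJ` and `C(π, J) = 0`. -/
structure Compatible (π : BivectorField E M) (J : TensorField E M) : Prop where
  comm : ∀ (α : OneForm E M) (x : M), J x (π.sharp x (α x)) = π.sharp x (transpose J α x)
  concomitant_eq_zero : ∀ (α β : OneForm E M) (x : M), concomitant π.sharp J α β x = 0

/-- `(M, π, J)` is a Poisson-Nijenhuis manifold. -/
structure IsPoissonNijenhuis (π : BivectorField E M) (J : TensorField E M) : Prop where
  poisson : IsPoisson π
  nijenhuis : IsNijenhuis J
  compatible : Compatible π J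

/-- `π` is homogeneous with respect to `Z`: `[Z, π] = -π`. -/
def IsHomogeneous (π : BivectorField E M) (Z : VectorField E M) : Prop :=
  ∀ (α β : OneForm E M) (x : M), lieBivector Z π.sharp α β x = - pair π.sharp α β x

/-- `(M, π, Z)` is a homogeneous Poisson manifold. -/
structure IsHomogeneousPoisson (π : BivectorField E M) (Z : VectorField E M) : Prop where
  poisson : IsPoisson π
  homogeneous : IsHomogeneous π Z

/-- `(M, π, J)` is a homogeneous Poisson-Nijenhuis manifold with respect to `Z`: `(M, π, Z)` is a
homogeneous Poisson manifold, `J` is a Nijenhuis tensor compatible with `π`, and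
`π ∘ (L_Z ∘ ᵗJ - ᵗJ ∘ L_Z) = 0` on 1-forms. -/
structure IsHomogeneousPoissonNijenhuis (π : BivectorField E M) (J : TensorField E M)
    (Z : VectorField E M) : Prop where
  homogeneousPoisson : IsHomogeneousPoisson π Z
  nijenhuis : IsNijenhuis J
  compatible : Compatible π J
  lie_comm : ∀ (α : OneForm E M) (x : M),
    π.sharp x (lieForm Z (transpose J α) x - transpose J (lieForm Z α) x) = 0

end Structures

end PoissonNijenhuis

end

/-!
Evaluating on a vector field `X`, Cartan's formula `(L_Z α)(X) = Z(α(X)) - α([Z, X])` gives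
`(L_Z (ᵗJ α))(X) - (ᵗJ (L_Z α))(X) = α([Z, JX] - J[Z, X])`, because the two terms
`Z(α(JX))` cancel. A bump function extends every tangent vector to a global smooth vector field, so
`[Z, JX] = J[Z, X]` for all `X` makes `L_Z` commute with `ᵗJ`, even before `π` is applied.
Cartan's formula is a pointwise identity that can be checked in a chart, where `[Z, X]` is
`DX(Z) - DZ(X)` and the product rule for the functions `α(X)` and `α(Z)` yields it.
-/

namespace PoissonNijenhuis

open Bundle Topology

section Flat

variable {𝕜 E F : Type*} [NontriviallyNormedField 𝕜]
  [NormedAddCommGroup E] [NormedSpace 𝕜 E] [NormedAddCommGroup F] [NormedSpace 𝕜 F]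

theorem fderiv_apply_sub_fderiv_apply_swap {a : E → E →L[𝕜] F} {V W : E → E} {x : E}
    (ha : DifferentiableAt 𝕜 a x) (hV : DifferentiableAt 𝕜 V x) (hW : DifferentiableAt 𝕜 W x) :
    fderiv 𝕜 a x (V x) (W x) - fderiv 𝕜 a x (W x) (V x) =
      fderiv 𝕜 (fun y => a y (W y)) x (V x) - fderiv 𝕜 (fun y => a y (V y)) x (W x) -
        a x (VectorField.lieBracket 𝕜 V W x) := by
  rw [fderiv_clm_apply ha hW, fderiv_clm_apply ha hV, VectorField.lieBracket_eq]
  simp only [add_apply, ContinuousLinearMap.comp_apply, ContinuousLinearMap.flip_apply, map_sub]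
  abel

end Flat

section VectorBundle

variable {E H M : Type*} [NormedAddCommGroup E] [NormedSpace ℝ E] [FiniteDimensional ℝ E]
  [TopologicalSpace H] {I : ModelWithCorners ℝ E H}
  [TopologicalSpace M] [ChartedSpace H M] [IsManifold I ∞ M] [T2Space M]
  {F : Type*} [NormedAddCommGroup F] [NormedSpace ℝ F]
  {V : M → Type*} [TopologicalSpace (TotalSpace F V)]
  [∀ x, AddCommGroup (V x)] [∀ x, Module ℝ (V x)] [∀ x, TopologicalSpace (V x)]
  [FiberBundle F V] [VectorBundle ℝ F V] [ContMDiffVectorBundle ∞ F V I]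

variable (I F) in
theorem exists_contMDiffSection_apply_eq (x : M) (v : V x) :
    ∃ s : Cₛ^∞⟮I; F, V⟯, s x = v := by
  obtain ⟨U, hU, hv⟩ := FiberBundle.exists_contMDiffOn_extend (k := ∞) I F v
  obtain ⟨f, -, hf⟩ := (SmoothBumpFunction.nhds_basis_tsupport (I := I) x).mem_iff.1
    (interior_mem_nhds.2 hU)
  refine ⟨⟨fun y => f y • FiberBundle.extend F v y, ?_⟩, ?_⟩
  · exact ContMDiffOn.smul_section_of_tsupport f.contMDiff.contMDiffOn isOpen_interior hf
      (hv.mono interior_subset)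
  · change f x • FiberBundle.extend F v x = v
    rw [f.eq_one, one_smul, FiberBundle.extend_apply_self]

end VectorBundle

section HomBundle

variable {𝕜 E H M : Type*} [NontriviallyNormedField 𝕜] [NormedAddCommGroup E] [NormedSpace 𝕜 E]
  [TopologicalSpace H] {I : ModelWithCorners 𝕜 E H} [TopologicalSpace M] [ChartedSpace H M]
  {F₁ F₂ F₃ : Type*} [NormedAddCommGroup F₁] [NormedSpace 𝕜 F₁] [NormedAddCommGroup F₂]
  [NormedSpace 𝕜 F₂] [NormedAddCommGroup F₃] [NormedSpace 𝕜 F₃]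
  {V₁ V₂ V₃ : M → Type*}
  [TopologicalSpace (TotalSpace F₁ V₁)] [∀ x, AddCommGroup (V₁ x)] [∀ x, Module 𝕜 (V₁ x)]
  [∀ x, TopologicalSpace (V₁ x)] [FiberBundle F₁ V₁] [VectorBundle 𝕜 F₁ V₁]
  [TopologicalSpace (TotalSpace F₂ V₂)] [∀ x, AddCommGroup (V₂ x)] [∀ x, Module 𝕜 (V₂ x)]
  [∀ x, TopologicalSpace (V₂ x)] [FiberBundle F₂ V₂] [VectorBundle 𝕜 F₂ V₂]
  [∀ x, IsTopologicalAddGroup (V₂ x)] [∀ x, ContinuousSMul 𝕜 (V₂ x)]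
  [TopologicalSpace (TotalSpace F₃ V₃)] [∀ x, AddCommGroup (V₃ x)] [∀ x, Module 𝕜 (V₃ x)]
  [∀ x, TopologicalSpace (V₃ x)] [FiberBundle F₃ V₃] [VectorBundle 𝕜 F₃ V₃]
  [∀ x, IsTopologicalAddGroup (V₃ x)] [∀ x, ContinuousSMul 𝕜 (V₃ x)]

variable (I F₁ F₂) in
/-- Differentiability at `x` of a section `A` of the bundle `Hom(V₁, V₂)`. The model fibres `F₁`
and `F₂` are explicit, since they cannot be recovered from `A`. -/
abbrev MDifferentiableHomAt (A : ∀ x : M, V₁ x →L[𝕜] V₂ x) (x : M) : Prop :=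
  MDifferentiableAt I (I.prod 𝓘(𝕜, F₁ →L[𝕜] F₂))
    (fun y => TotalSpace.mk' (F₁ →L[𝕜] F₂) (E := fun y => V₁ y →L[𝕜] V₂ y) y (A y)) x

theorem MDifferentiableHomAt.comp {A : ∀ x : M, V₂ x →L[𝕜] V₃ x}
    {B : ∀ x : M, V₁ x →L[𝕜] V₂ x} {x : M}
    (hA : MDifferentiableHomAt I F₂ F₃ A x) (hB : MDifferentiableHomAt I F₁ F₂ B x) :
    MDifferentiableHomAt I F₁ F₃ (fun y => (A y).comp (B y)) x := by
  rw [MDifferentiableHomAt, mdifferentiableAt_hom_bundle] at hA hB ⊢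
  refine ⟨mdifferentiableAt_id, (hA.2.clm_comp hB.2).congr_of_eventuallyEq ?_⟩
  filter_upwards [(trivializationAt F₂ V₂ x).open_baseSet.mem_nhds
    (FiberBundle.mem_baseSet_trivializationAt' x)] with y hy
  ext v
  simp only [ContinuousLinearMap.inCoordinates, ContinuousLinearMap.comp_apply,
    Trivialization.symmL_continuousLinearMapAt _ hy]

end HomBundle

section ChartDerivative

variable {𝕜 E : Type*} [NontriviallyNormedField 𝕜] [NormedAddCommGroup E] [NormedSpace 𝕜 E]
  {M : Type*} [TopologicalSpace M] [ChartedSpace E M] [IsManifold 𝓘(𝕜, E) 1 M] {x : M}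

theorem mfderiv_extChartAt_symm_self (x : M) :
    (mfderiv 𝓘(𝕜, E) 𝓘(𝕜, E) (extChartAt 𝓘(𝕜, E) x).symm (extChartAt 𝓘(𝕜, E) x x) : E →L[𝕜] E)
      = ContinuousLinearMap.id 𝕜 E := by
  have h := mfderivWithin_range_extChartAt_symm (I := 𝓘(𝕜, E)) (x := x)
  simp only [modelWithCornersSelf_coe, Set.range_id, mfderivWithin_univ] at h
  exact h

theorem isInvertible_mfderiv_extChartAt_symm {y : E} (hy : y ∈ (extChartAt 𝓘(𝕜, E) x).target) :
    (mfderiv 𝓘(𝕜, E) 𝓘(𝕜, E) (extChartAt 𝓘(𝕜, E) x).symm y).IsInvertible := by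
  simpa only [modelWithCornersSelf_coe, Set.range_id, mfderivWithin_univ] using
    isInvertible_mfderivWithin_extChartAt_symm hy

theorem symmL_trivializationAt_extChartAt_symm {y : E}
    (hy : y ∈ (extChartAt 𝓘(𝕜, E) x).target) :
    (trivializationAt E (TangentSpace 𝓘(𝕜, E)) x).symmL 𝕜 ((extChartAt 𝓘(𝕜, E) x).symm y) =
      mfderiv 𝓘(𝕜, E) 𝓘(𝕜, E) (extChartAt 𝓘(𝕜, E) x).symm y := by
  have hz := (extChartAt 𝓘(𝕜, E) x).map_target hy
  rw [extChartAt_source] at hz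
  have h := TangentBundle.symmL_trivializationAt (I := 𝓘(𝕜, E)) hz
  rw [(extChartAt 𝓘(𝕜, E) x).right_inv hy] at h
  simpa only [modelWithCornersSelf_coe, Set.range_id, mfderivWithin_univ] using h

theorem mdifferentiableAt_extChartAt_symm {y : E} (hy : y ∈ (extChartAt 𝓘(𝕜, E) x).target) :
    MDifferentiableAt 𝓘(𝕜, E) 𝓘(𝕜, E) (extChartAt 𝓘(𝕜, E) x).symm y := by
  simpa only [modelWithCornersSelf_coe, Set.range_id, mdifferentiableWithinAt_univ] using
    mdifferentiableWithinAt_extChartAt_symm hy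

end ChartDerivative

section Chart

variable {E : Type*} [NormedAddCommGroup E] [NormedSpace ℝ E]
  {M : Type*} [TopologicalSpace M] [ChartedSpace E M]
  {J : ∀ x : M, TangentSpace 𝓘(ℝ, E) x →L[ℝ] TangentSpace 𝓘(ℝ, E) x}
  {α : ∀ x : M, TangentSpace 𝓘(ℝ, E) x →L[ℝ] ℝ} {X Y Z : ∀ x : M, TangentSpace 𝓘(ℝ, E) x} {x : M}

theorem dFun_eq_fderiv {f : M → ℝ} (hf : MDiffAt f x) :
    dFun f x = fderiv ℝ (f ∘ (extChartAt 𝓘(ℝ, E) x).symm) (extChartAt 𝓘(ℝ, E) x x) := by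
  rw [dFun, hf.mfderiv, modelWithCornersSelf_coe, Set.range_id, fderivWithin_univ]
  rfl

variable [IsManifold 𝓘(ℝ, E) 1 M]

theorem formInChart_self (α : ∀ x : M, TangentSpace 𝓘(ℝ, E) x →L[ℝ] ℝ) (x : M) :
    formInChart α x (extChartAt 𝓘(ℝ, E) x x) = α x := by
  -- `α` is a dependent function, so `φ⁻¹ (φ x) = x` cannot simply be rewritten in its argument.
  have hα : ∀ z : M, z = x → (α z : E →L[ℝ] ℝ) = α x := by rintro _ rfl; rfl
  exact (congrArg₂ (fun (a : E →L[ℝ] ℝ) (L : E →L[ℝ] E) => a.comp L)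
    (hα _ (extChartAt_to_inv x)) (mfderiv_extChartAt_symm_self x)).trans
      (ContinuousLinearMap.comp_id _)

theorem formInChart_eq_inCoordinates (α : ∀ x : M, TangentSpace 𝓘(ℝ, E) x →L[ℝ] ℝ)
    {y : E} (hy : y ∈ (extChartAt 𝓘(ℝ, E) x).target) :
    formInChart α x y =
      ContinuousLinearMap.inCoordinates E (TangentSpace 𝓘(ℝ, E)) ℝ (fun _ : M => ℝ)
        x ((extChartAt 𝓘(ℝ, E) x).symm y) x ((extChartAt 𝓘(ℝ, E) x).symm y)
        (α ((extChartAt 𝓘(ℝ, E) x).symm y)) := by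
  rw [ContinuousLinearMap.inCoordinates, symmL_trivializationAt_extChartAt_symm hy]
  ext v
  exact (DFunLike.congr_fun (Trivial.continuousLinearMapAt_trivialization ℝ M ℝ _) _).symm

theorem differentiableAt_formInChart (hα : MDifferentiableHomAt 𝓘(ℝ, E) E ℝ α x) :
    DifferentiableAt ℝ (formInChart α x) (extChartAt 𝓘(ℝ, E) x x) := by
  rw [MDifferentiableHomAt, mdifferentiableAt_hom_bundle] at hα
  refine (hα.2.comp_of_eq _ (mdifferentiableAt_extChartAt_symm (mem_extChartAt_target x))
    (extChartAt_to_inv x)).differentiableAt.congr_of_eventuallyEq ?_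
  filter_upwards [extChartAt_target_mem_nhds x] with y hy
  exact formInChart_eq_inCoordinates α hy

/-- The expression of a vector field in the preferred chart `φ` at `x`, that is `(φ⁻¹)^* X`, the
counterpart of `formInChart`. -/
noncomputable def vectorInChart (X : ∀ x : M, TangentSpace 𝓘(ℝ, E) x) (x : M) : E → E :=
  VectorField.mpullback 𝓘(ℝ, E) 𝓘(ℝ, E) (extChartAt 𝓘(ℝ, E) x).symm X

theorem vectorInChart_self (X : ∀ x : M, TangentSpace 𝓘(ℝ, E) x) (x : M) :
    vectorInChart X x (extChartAt 𝓘(ℝ, E) x x) = X x := by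
  have hX : ∀ z : M, z = x → (X z : E) = X x := by rintro _ rfl; rfl
  have hinv : (mfderiv 𝓘(ℝ, E) 𝓘(ℝ, E) (extChartAt 𝓘(ℝ, E) x).symm
      (extChartAt 𝓘(ℝ, E) x x) : E →L[ℝ] E).inverse = ContinuousLinearMap.id ℝ E :=
    (congrArg ContinuousLinearMap.inverse
      (mfderiv_extChartAt_symm_self x)).trans ContinuousLinearMap.inverse_id
  exact congrArg₂ (fun (L : E →L[ℝ] E) (w : E) => L w) hinv (hX _ (extChartAt_to_inv x))

theorem vectorInChart_eq_trivializationAt (X : ∀ x : M, TangentSpace 𝓘(ℝ, E) x)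
    {y : E} (hy : y ∈ (extChartAt 𝓘(ℝ, E) x).target) :
    vectorInChart X x y =
      (trivializationAt E (TangentSpace 𝓘(ℝ, E)) x (X ((extChartAt 𝓘(ℝ, E) x).symm y))).2 := by
  have hz : (extChartAt 𝓘(ℝ, E) x).symm y ∈
      (trivializationAt E (TangentSpace 𝓘(ℝ, E)) x).baseSet := by
    rw [TangentBundle.trivializationAt_baseSet, ← extChartAt_source 𝓘(ℝ, E)]
    exact (extChartAt 𝓘(ℝ, E) x).map_target hy
  rw [vectorInChart, VectorField.mpullback_apply]
  refine (isInvertible_mfderiv_extChartAt_symm hy).inverse_apply_eq.2 ?_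
  rw [← symmL_trivializationAt_extChartAt_symm hy,
    ← Trivialization.continuousLinearMapAt_apply_of_mem ℝ _ hz]
  exact (Trivialization.symmL_continuousLinearMapAt _ hz _).symm

theorem differentiableAt_vectorInChart (hX : MDiffAt (T% X) x) :
    DifferentiableAt ℝ (vectorInChart X x) (extChartAt 𝓘(ℝ, E) x x) := by
  rw [mdifferentiableAt_section] at hX
  refine (hX.comp_of_eq _ (mdifferentiableAt_extChartAt_symm (mem_extChartAt_target x))
    (extChartAt_to_inv x)).differentiableAt.congr_of_eventuallyEq ?_
  filter_upwards [extChartAt_target_mem_nhds x] with y hy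
  exact vectorInChart_eq_trivializationAt X hy

theorem bracket_eq_lieBracket (X Y : ∀ x : M, TangentSpace 𝓘(ℝ, E) x) (x : M) :
    bracket X Y x = VectorField.lieBracket ℝ (vectorInChart X x) (vectorInChart Y x)
      (extChartAt 𝓘(ℝ, E) x x) := by
  rw [bracket, ← VectorField.mlieBracketWithin_univ, VectorField.mlieBracketWithin_apply,
    mfderiv_extChartAt_self]
  simp only [modelWithCornersSelf_coe, Set.range_id, Set.preimage_univ, Set.inter_univ,
    VectorField.mpullbackWithin_univ]
  refine (DFunLike.congr_fun (ContinuousLinearMap.inverse_id (R := ℝ) (M := E)) _).trans ?_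
  exact congrFun (VectorField.lieBracketWithin_univ (𝕜 := ℝ) (V := vectorInChart X x)
    (W := vectorInChart Y x)) _

theorem formInChart_apply_vectorInChart (α : ∀ x : M, TangentSpace 𝓘(ℝ, E) x →L[ℝ] ℝ)
    (X : ∀ x : M, TangentSpace 𝓘(ℝ, E) x) {y : E} (hy : y ∈ (extChartAt 𝓘(ℝ, E) x).target) :
    formInChart α x y (vectorInChart X x y) =
      α ((extChartAt 𝓘(ℝ, E) x).symm y) (X ((extChartAt 𝓘(ℝ, E) x).symm y)) := by
  rw [formInChart, vectorInChart, VectorField.mpullback_apply]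
  exact congrArg _ ((isInvertible_mfderiv_extChartAt_symm hy).self_apply_inverse _)

theorem mdifferentiableAt_form_apply (hα : MDifferentiableHomAt 𝓘(ℝ, E) E ℝ α x)
    (hX : MDiffAt (T% X) x) : MDiffAt (fun y => α y (X y)) x := by
  have h := MDifferentiableAt.clm_bundle_apply (E₂ := fun _ : M => ℝ) hα hX
  rwa [mdifferentiableAt_section] at h

theorem dFun_form_apply_eq_fderiv (hα : MDifferentiableHomAt 𝓘(ℝ, E) E ℝ α x)
    (hX : MDiffAt (T% X) x) :
    dFun (fun y => α y (X y)) x =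
      fderiv ℝ (fun y => formInChart α x y (vectorInChart X x y)) (extChartAt 𝓘(ℝ, E) x x) := by
  rw [dFun_eq_fderiv (mdifferentiableAt_form_apply hα hX)]
  refine Filter.EventuallyEq.fderiv_eq ?_
  filter_upwards [extChartAt_target_mem_nhds x] with y hy
  exact (formInChart_apply_vectorInChart α X hy).symm

theorem dForm_apply (α : ∀ x : M, TangentSpace 𝓘(ℝ, E) x →L[ℝ] ℝ) (x : M)
    (u v : TangentSpace 𝓘(ℝ, E) x) :
    dForm α x u v =
      fderiv ℝ (formInChart α x) (extChartAt 𝓘(ℝ, E) x x) u v -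
        fderiv ℝ (formInChart α x) (extChartAt 𝓘(ℝ, E) x x) v u := by
  have hid : (mfderiv 𝓘(ℝ, E) 𝓘(ℝ, E) (extChartAt 𝓘(ℝ, E) x) x : E →L[ℝ] E) =
      ContinuousLinearMap.id ℝ E := mfderiv_extChartAt_self
  let D : E →L[ℝ] E →L[ℝ] ℝ := fderiv ℝ (formInChart α x) (extChartAt 𝓘(ℝ, E) x x)
  exact congrArg (fun p : E →L[ℝ] E => (D - D.flip) (p u) (p v)) hid

theorem dForm_apply_vectorField (hα : MDifferentiableHomAt 𝓘(ℝ, E) E ℝ α x)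
    (hX : MDiffAt (T% X) x) (hY : MDiffAt (T% Y) x) :
    dForm α x (X x) (Y x) =
      dFun (fun y => α y (Y y)) x (X x) - dFun (fun y => α y (X y)) x (Y x) -
        α x (bracket X Y x) := by
  have h := fderiv_apply_sub_fderiv_apply_swap (differentiableAt_formInChart hα)
    (differentiableAt_vectorInChart hX) (differentiableAt_vectorInChart hY)
  rw [vectorInChart_self, vectorInChart_self, formInChart_self] at h
  rw [dForm_apply, dFun_form_apply_eq_fderiv hα hX, dFun_form_apply_eq_fderiv hα hY,
    bracket_eq_lieBracket]
  exact h

theorem lieForm_apply_vectorField (hα : MDifferentiableHomAt 𝓘(ℝ, E) E ℝ α x)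
    (hZ : MDiffAt (T% Z) x) (hX : MDiffAt (T% X) x) :
    lieForm Z α x (X x) = dFun (fun y => α y (X y)) x (Z x) - α x (bracket Z X x) := by
  rw [lieForm, add_apply, dForm_apply_vectorField hα hZ hX]
  ring

theorem lieForm_transpose_apply_sub (hJ : MDifferentiableHomAt 𝓘(ℝ, E) E E J x)
    (hα : MDifferentiableHomAt 𝓘(ℝ, E) E ℝ α x)
    (hZ : MDiffAt (T% Z) x) (hX : MDiffAt (T% X) x) :
    lieForm Z (transpose J α) x (X x) - transpose J (lieForm Z α) x (X x) =
      α x (bracket Z (fun y => J y (X y)) x - J x (bracket Z X x)) := by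
  have hl := lieForm_apply_vectorField (hα.comp hJ) hZ hX
  have hr := lieForm_apply_vectorField hα hZ (hJ.clm_bundle_apply hX)
  calc lieForm Z (transpose J α) x (X x) - transpose J (lieForm Z α) x (X x)
      = dFun (fun y => α y (J y (X y))) x (Z x) - α x (J x (bracket Z X x)) -
          (dFun (fun y => α y (J y (X y))) x (Z x) - α x (bracket Z (fun y => J y (X y)) x)) :=
        congrArg₂ (· - ·) hl hr
    _ = α x (bracket Z (fun y => J y (X y)) x - J x (bracket Z X x)) := by
        rw [map_sub, sub_sub_sub_cancel_left]

end Chart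

theorem lieForm_transpose {E : Type*} [NormedAddCommGroup E] [NormedSpace ℝ E]
    [FiniteDimensional ℝ E] {M : Type*} [TopologicalSpace M] [T2Space M] [ChartedSpace E M]
    [IsManifold 𝓘(ℝ, E) ∞ M] (J : TensorField E M) (Z : VectorField E M)
    (hJ : ∀ (X : VectorField E M) (x : M),
      bracket Z (fun y => J y (X y)) x = J x (bracket Z X x)) (α : OneForm E M) (x : M) :
    lieForm Z (transpose J α) x = transpose J (lieForm Z α) x := by
  have : IsManifold 𝓘(ℝ, E) 1 M := IsManifold.of_le (n := ∞) (by simp)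
  ext v
  obtain ⟨X, rfl⟩ := exists_contMDiffSection_apply_eq 𝓘(ℝ, E) E x v
  rw [← sub_eq_zero, lieForm_transpose_apply_sub J.mdifferentiableAt α.mdifferentiableAt
    Z.mdifferentiableAt X.mdifferentiableAt, hJ, sub_self, map_zero]

end PoissonNijenhuis

theorem mainTheorem9
    {E : Type*} [NormedAddCommGroup E] [NormedSpace ℝ E] [FiniteDimensional ℝ E]
    {M : Type*} [TopologicalSpace M] [T2Space M] [ChartedSpace E M] [IsManifold 𝓘(ℝ, E) ∞ M]
    (π : PoissonNijenhuis.BivectorField E M) (J : PoissonNijenhuis.TensorField E M)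
    (Z : PoissonNijenhuis.VectorField E M)
    (hPN : PoissonNijenhuis.IsPoissonNijenhuis π J)
    (hZ : PoissonNijenhuis.IsHomogeneous π Z)
    (hJ : ∀ (X : PoissonNijenhuis.VectorField E M) (x : M),
      PoissonNijenhuis.bracket Z (fun y => J y (X y)) x =
        J x (PoissonNijenhuis.bracket Z X x)) :
    PoissonNijenhuis.IsHomogeneousPoissonNijenhuis π J Z where
  homogeneousPoisson := ⟨hPN.poisson, hZ⟩
  nijenhuis := hPN.nijenhuis
  compatible := hPN.compatible
  lie_comm α x := by
    rw [PoissonNijenhuis.lieForm_transpose J Z hJ α x, sub_self, map_zero]
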